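/- Let $G$ be a finite group of order $N$, let $S\subseteq G$ be closed under conjugation, and let $\Gamma=\mathrm{Cay}(G;S)$ be the (possibly directed) Cayley graph with vertex set $G$ and an edge from $x$ to $y$ exactly when $x^{-1}y\in S$. Let $\widehat G$ be a set of irreducible unitary matrix representations $\pi:G\to \mathrm U_{d_\pi}(\mathbb C)$ containing exactly one member of each equivalence class, and equip $\mathbb C^G$ with the orthonormal basis $$\phi^\pi_{i,j}(x)=\sqrt{\tfrac{d_\pi}{N}}\,\pi(x)_{i,j}\qquad(\pi\in\widehat G,\ 1\le i,j\le d_\pi),$$ which consists of eigenvectors of the adjacency matrix of $\Gamma$. For $f:G\to\mathbb C$ let $\widehat f(\phi^\pi_{i,j})=\sum_{x\in G}f(x)\overline{\phi^\pi_{i,j}(x)}$ be its graph Fourier transform, let $$f*h=\sum_{\pi,i,j}\widehat f(\phi^\pi_{i,j})\,\widehat h(\phi^\pi_{i,j})\,\phi^\pi_{i,j}$$ be the graph convolution, and for $\ell\in G$ let $T_\ell f=\sqrt N\,(f*\delta_\ell)$ be the graph translation, where $\delta_\ell$ is the indicator function of $\{\ell\}$. Let $L$ be the left regular representation, $(L(a)f)(h)=f(a^{-1}h)$,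 and let $e$ be the identity of $G$. Suppose that $g:G\to\mathbb C$ is such that for every $\pi\in\widehat G$ the coefficient $\widehat g(\phi^\pi_{i,j})$ does not depend on $i,j$. Then for all $\ell,k,m\in G$ $$(T_\ell g)(k)=(T_{\ell m}g)(km)=(T_{m\ell}g)(mk).$$ In particular, for all $\ell,k\in G$, $(T_\ell g)(k)=(T_e g)(\ell^{-1}k)$, that is, $T_\ell g=L(\ell)(T_e g)$. -/

import Mathlib

open scoped ComplexConjugate

/-! ### Graph signal processing -/

/-- The `0`/`1` adjacency matrix of a (possibly directed) graph. -/
noncomputable def Digraph.adjacencyMatrix {V : Type*} (Γ : Digraph V) : Matrix V V ℂ :=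
  open Classical in Matrix.of fun x y => if Γ.Adj x y then 1 else 0

/-- A graph Fourier basis for a graph matrix `M`: an orthonormal basis of `ℂ^V` consisting of
eigenvectors of `M`. -/
structure GraphFourierBasis {V : Type*} [Fintype V] (M : Matrix V V ℂ)
    (ι : Type*) [Fintype ι] where
  /-- The underlying orthonormal basis. -/
  basis : OrthonormalBasis ι ℂ (EuclideanSpace ℂ V)
  eigenvector : ∀ i, ∃ μ : ℂ, M.mulVec (basis i).ofLp = μ • (basis i).ofLp

namespace GraphFourierBasis

variable {V : Type*} [Fintype V] {M : Matrix V V ℂ} {ι : Type*} [Fintype ι]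

/-- The graph Fourier transform: the coefficient of `f` at `φ_i` is `∑ₓ f(x) conj(φ_i(x))`. -/
noncomputable def fourier (Φ : GraphFourierBasis M ι) (f : V → ℂ) : ι → ℂ :=
  fun i => ∑ x, f x * conj (Φ.basis i x)

/-- The inverse graph Fourier transform. -/
noncomputable def fourierInv (Φ : GraphFourierBasis M ι) (F : ι → ℂ) : V → ℂ :=
  fun x => ∑ i, F i * Φ.basis i x

/-- Convolution of graph signals: the pointwise product in the Fourier domain. -/
noncomputable def conv (Φ : GraphFourierBasis M ι) (f g : V → ℂ) : V → ℂ :=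
  Φ.fourierInv (Φ.fourier f * Φ.fourier g)

open Classical in
/-- Graph translation: `T_ℓ f = √N (f * δ_ℓ)`, where `N` is the number of vertices. -/
noncomputable def translate (Φ : GraphFourierBasis M ι) (ℓ : V) (f : V → ℂ) : V → ℂ :=
  ((Real.sqrt (Fintype.card V) : ℝ) : ℂ) • Φ.conv f (Pi.single ℓ 1)

end GraphFourierBasis

/-! ### Unitary representations -/

/-- A unitary matrix representation `G → U_d(ℂ)`, seen as a representation on `ℂ^d`. -/
noncomputable def unitaryRepresentation {G : Type*} [Group G] {d : ℕ}
    (π : G →* Matrix.unitaryGroup (Fin d) ℂ) : Representation ℂ G (Fin d → ℂ) :=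
  ((Matrix.toLinAlgEquiv' : Matrix (Fin d) (Fin d) ℂ ≃ₐ[ℂ] ((Fin d → ℂ) →ₗ[ℂ] (Fin d → ℂ))) :
    Matrix (Fin d) (Fin d) ℂ →* ((Fin d → ℂ) →ₗ[ℂ] (Fin d → ℂ))).comp
      ((Matrix.unitaryGroup (Fin d) ℂ).subtype.comp π)

/-- The unitary dual of `G`: a family, indexed by `κ`, of irreducible unitary matrix
representations that contains exactly one member of each equivalence class. -/
structure UnitaryDual (G : Type*) [Group G] (κ : Type*) where
  /-- The degrees of the representations. -/
  degree : κ → ℕ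
  /-- The chosen representatives. -/
  rep : ∀ k, G →* Matrix.unitaryGroup (Fin (degree k)) ℂ
  irreducible : ∀ k, (unitaryRepresentation (rep k)).IsIrreducible
  eq_of_equiv : ∀ k l,
    Nonempty ((unitaryRepresentation (rep k)).Equiv (unitaryRepresentation (rep l))) → k = l
  exists_equiv : ∀ (d : ℕ) (ρ : G →* Matrix.unitaryGroup (Fin d) ℂ),
    (unitaryRepresentation ρ).IsIrreducible →
      ∃ k, Nonempty ((unitaryRepresentation ρ).Equiv (unitaryRepresentation (rep k)))

/-- The left regular representation of `G` on functions, `(L(a) f)(h) = f(a⁻¹ h)`. -/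
def leftRegularOnFunctions (G : Type*) [Group G] : Representation ℂ G (G → ℂ) where
  toFun a := { toFun := fun f h => f (a⁻¹ * h)
               map_add' := fun _ _ => rfl
               map_smul' := fun _ _ => rfl }
  map_one' := by ext; simp
  map_mul' a b := by ext; simp [mul_assoc]

/-! ### Cayley graphs and their preferred eigenbasis -/

/-- The Cayley graph `Cay(G; S)`: there is an edge from `x` to `y` iff `x⁻¹ y ∈ S`. -/
def cayleyGraph {G : Type*} [Group G] (S : Set G) : Digraph G where
  Adj x y := x⁻¹ * y ∈ S

namespace UnitaryDual

variable {G : Type*} [Group G] {κ : Type*}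

/-- Indices of the matrix coefficients `π_{i,j}`, with `π` in the dual and `1 ≤ i, j ≤ d_π`. -/
abbrev Index (D : UnitaryDual G κ) : Type _ :=
  Σ k : κ, Fin (D.degree k) × Fin (D.degree k)

/-- The matrix coefficient `π_{i,j}` of the `k`-th representation `π`. -/
def coeff (D : UnitaryDual G κ) (k : κ) (i j : Fin (D.degree k)) (x : G) : ℂ :=
  (D.rep k x : Matrix (Fin (D.degree k)) (Fin (D.degree k)) ℂ) i j

/-- The scaled matrix coefficient `√(d_π / N) π_{i,j}`, where `N` is the order of `G`. -/
noncomputable def scaledCoeff [Fintype G] (D : UnitaryDual G κ) (p : D.Index) :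
    EuclideanSpace ℂ G :=
  WithLp.toLp 2 fun x =>
    ((Real.sqrt ((D.degree p.1 : ℝ) / (Fintype.card G : ℝ)) : ℝ) : ℂ) *
      D.coeff p.1 p.2.1 p.2.2 x

/-- A linear map that commutes with the action of one irreducible representation is a scalar. -/
theorem schur_scalar (D : UnitaryDual G κ) (k : κ)
    (Y : Matrix (Fin (D.degree k)) (Fin (D.degree k)) ℂ)
    (hY : ∀ h, Y * (D.rep k h).1 = (D.rep k h).1 * Y) : ∃ c : ℂ, Y = c • 1 := by
  have := D.irreducible k
  let f : (unitaryRepresentation (D.rep k)).IntertwiningMap (unitaryRepresentation (D.rep k)) :=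
    { toLinearMap := Matrix.toLin' Y
      isIntertwining' := fun h => by
        have := congrArg Matrix.toLin' (hY h)
        rwa [Matrix.toLin'_mul, Matrix.toLin'_mul] at this }
  obtain ⟨c, hc⟩ := (Representation.IsIrreducible.algebraMap_intertwiningMap_bijective_of_isAlgClosed
    (ρ := unitaryRepresentation (D.rep k))).2 f
  refine ⟨c, ?_⟩
  apply Matrix.toLin'.injective
  have h2 : f.toLinearMap = Matrix.toLin' Y := rfl
  rw [← h2, ← hc]
  ext v
  simp [Algebra.algebraMap_eq_smul_one]

/-- There is no nonzero intertwiner between two different members of the dual. -/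
theorem schur_zero (D : UnitaryDual G κ) {k l : κ} (hkl : k ≠ l)
    (Y : Matrix (Fin (D.degree k)) (Fin (D.degree l)) ℂ)
    (hY : ∀ h, Y * (D.rep l h).1 = (D.rep k h).1 * Y) : Y = 0 := by
  have := D.irreducible k
  have := D.irreducible l
  let f : (unitaryRepresentation (D.rep l)).IntertwiningMap (unitaryRepresentation (D.rep k)) :=
    { toLinearMap := Matrix.toLin' Y
      isIntertwining' := fun h => by
        have := congrArg Matrix.toLin' (hY h)
        rwa [Matrix.toLin'_mul, Matrix.toLin'_mul] at this }
  rcases Representation.IsIrreducible.bijective_or_eq_zero f with h | h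
  · exact absurd (D.eq_of_equiv l k ⟨f.ofBijective h⟩).symm hkl
  · apply Matrix.toLin'.injective
    have h2 : f.toLinearMap = Matrix.toLin' Y := rfl
    rw [← h2, h]
    simp

theorem degree_pos (D : UnitaryDual G κ) (k : κ) : 0 < D.degree k := by
  have := D.irreducible k
  by_contra h0
  have h1 : IsEmpty (Fin (D.degree k)) := by
    rw [Nat.eq_zero_of_not_pos h0]; infer_instance
  have : Subsingleton (Subrepresentation (unitaryRepresentation (D.rep k))) :=
    Subrepresentation.toSubmodule_injective.subsingleton
  exact not_subsingleton _ this

/-- The averaged matrix `∑ₓ π_k(x) X π_l(x)*`. -/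
theorem average_intertwines [Fintype G] (D : UnitaryDual G κ) (k l : κ)
    (X : Matrix (Fin (D.degree k)) (Fin (D.degree l)) ℂ) (h : G) :
    (∑ x, (D.rep k x).1 * X * star (D.rep l x).1) * (D.rep l h).1 =
      (D.rep k h).1 * ∑ x, (D.rep k x).1 * X * star (D.rep l x).1 := by
  rw [Matrix.sum_mul, Matrix.mul_sum, ← Equiv.sum_comp (Equiv.mulLeft h)]
  refine Finset.sum_congr rfl fun x _ => ?_
  have hu : star (D.rep l h).1 * (D.rep l h).1 = 1 := (D.rep l h).2.1
  simp only [Equiv.coe_mulLeft, map_mul, Submonoid.coe_mul, star_mul, Matrix.mul_assoc, hu,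
    Matrix.mul_one]

theorem average_apply [Fintype G] (D : UnitaryDual G κ) (k l : κ)
    (a b : Fin (D.degree k)) (a' b' : Fin (D.degree l)) :
    (∑ x, (D.rep k x).1 * Matrix.single b b' (1 : ℂ) * star (D.rep l x).1) a a' =
      ∑ x, D.coeff k a b x * conj (D.coeff l a' b' x) := by
  rw [Matrix.sum_apply]
  refine Finset.sum_congr rfl fun x _ => ?_
  rw [Matrix.mul_apply, Finset.sum_eq_single b']
  · simp [coeff, Matrix.star_apply]
  · intro j _ hj
    simp [Matrix.mul_single_apply_of_ne _ _ _ _ _ hj]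
  · simp

theorem inner_scaledCoeff [Fintype G] (D : UnitaryDual G κ) (p q : D.Index) :
    inner ℂ (D.scaledCoeff p) (D.scaledCoeff q) =
      (Real.sqrt ((D.degree p.1 : ℝ) / (Fintype.card G : ℝ)) : ℂ) *
      (Real.sqrt ((D.degree q.1 : ℝ) / (Fintype.card G : ℝ)) : ℂ) *
      ∑ x, D.coeff q.1 q.2.1 q.2.2 x * conj (D.coeff p.1 p.2.1 p.2.2 x) := by
  rw [PiLp.inner_apply, Finset.mul_sum]
  refine Finset.sum_congr rfl fun x _ => ?_
  simp only [scaledCoeff, RCLike.inner_apply, map_mul, Complex.conj_ofReal]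
  ring

/-- The Schur orthogonality relations. -/
theorem orthonormal_scaledCoeff [Fintype G] (D : UnitaryDual G κ) :
    Orthonormal ℂ D.scaledCoeff := by
  classical
  rw [orthonormal_iff_ite]
  rintro ⟨l, a', b'⟩ ⟨k, a, b⟩
  rw [inner_scaledCoeff]
  simp only
  rw [← average_apply]
  by_cases hkl : k = l
  · subst hkl
    obtain ⟨c, hc⟩ := D.schur_scalar k _ (D.average_intertwines k k (Matrix.single b b' 1))
    have htr := congrArg Matrix.trace hc
    have h1 : ∀ x, Matrix.trace ((D.rep k x).1 * Matrix.single b b' (1 : ℂ) *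
        star (D.rep k x).1) = if b = b' then 1 else 0 := by
      intro x
      have hu : star (D.rep k x).1 * (D.rep k x).1 = 1 := (D.rep k x).2.1
      rw [Matrix.trace_mul_comm, ← Matrix.mul_assoc, hu, Matrix.one_mul]
      split_ifs with h
      · subst h; simp
      · exact Matrix.trace_single_eq_of_ne _ _ _ h
    rw [Matrix.trace_sum, Finset.sum_congr rfl (fun x _ => h1 x)] at htr
    simp only [Finset.sum_const, Finset.card_univ, Matrix.trace_smul, Matrix.trace_one,
      Fintype.card_fin, smul_eq_mul, nsmul_eq_mul] at htr
    rw [hc]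
    have hd : (D.degree k : ℂ) ≠ 0 := by exact_mod_cast (D.degree_pos k).ne'
    have hN : (Fintype.card G : ℂ) ≠ 0 := by exact_mod_cast Fintype.card_ne_zero
    rw [← Complex.ofReal_mul, Real.mul_self_sqrt (by positivity)]
    push_cast
    have hc' : c = (Fintype.card G : ℂ) * (if b = b' then 1 else 0) / D.degree k := by
      field_simp
      linear_combination -htr
    rw [hc']
    by_cases hb : b = b' <;> by_cases ha : a = a'
    · subst hb; subst ha; simp; field_simp
    · have : ¬ a' = a := fun h => ha h.symm
      simp [hb, ha, this]
    · have : ¬ b' = b := fun h => hb h.symm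
      simp [hb, ha, this]
    · have : ¬ b' = b := fun h => hb h.symm
      simp [hb, this]
  · rw [D.schur_zero hkl _ (D.average_intertwines k l (Matrix.single b b' 1))]
    have : ¬ l = k := fun h => hkl h.symm
    simp [this]

/-- The right regular representation on `ℂ^G`, used to see that the coefficients span. -/
def rightRegular (G : Type*) [Group G] :
    Representation ℂ G (EuclideanSpace ℂ G) where
  toFun a := { toFun := fun F => WithLp.toLp 2 fun x => F (x * a)
               map_add' := fun _ _ => rfl
               map_smul' := fun _ _ => rfl }
  map_one' := by ext; simp
  map_mul' a b := by
    ext F x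
    exact congrArg F (mul_assoc x a b).symm

theorem rightRegular_apply (a : G) (F : EuclideanSpace ℂ G) (x : G) :
    rightRegular G a F x = F (x * a) := rfl

theorem rightRegular_inv_apply (a : G) (F : EuclideanSpace ℂ G) :
    rightRegular G a (rightRegular G a⁻¹ F) = F := by
  ext x
  rw [rightRegular_apply, rightRegular_apply, mul_inv_cancel_right]

theorem inner_rightRegular [Fintype G] (a : G) (E F : EuclideanSpace ℂ G) :
    inner ℂ (rightRegular G a E) F = inner ℂ E (rightRegular G a⁻¹ F) := by
  rw [PiLp.inner_apply, PiLp.inner_apply, ← Equiv.sum_comp (Equiv.mulRight a⁻¹)]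
  refine Finset.sum_congr rfl fun x _ => ?_
  simp [rightRegular_apply]

theorem rightRegular_scaledCoeff [Fintype G] (D : UnitaryDual G κ) (a : G) (k : κ)
    (i j : Fin (D.degree k)) :
    rightRegular G a (D.scaledCoeff ⟨k, i, j⟩) =
      ∑ m, D.coeff k m j a • D.scaledCoeff ⟨k, i, m⟩ := by
  ext x
  simp only [rightRegular_apply, scaledCoeff, coeff, map_mul, Submonoid.coe_mul, Matrix.mul_apply,
    WithLp.ofLp_sum, WithLp.ofLp_smul, Finset.sum_apply, Pi.smul_apply, smul_eq_mul,
    Finset.mul_sum]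
  exact Finset.sum_congr rfl fun m _ => by ring

/-- A copy of a member of the dual in the right regular representation lies in the span of the
matrix coefficients. -/
theorem mem_span_of_intertwines [Fintype G] (D : UnitaryDual G κ) (k : κ)
    (t : (Fin (D.degree k) → ℂ) →ₗ[ℂ] EuclideanSpace ℂ G)
    (ht : ∀ a w, t (unitaryRepresentation (D.rep k) a w) = rightRegular G a (t w))
    (w : Fin (D.degree k) → ℂ) : t w ∈ Submodule.span ℂ (Set.range D.scaledCoeff) := by
  classical
  have hs : ((Real.sqrt ((D.degree k : ℝ) / (Fintype.card G : ℝ)) : ℝ) : ℂ) ≠ 0 := by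
    have := D.degree_pos k
    have : 0 < (D.degree k : ℝ) / (Fintype.card G : ℝ) := by
      have : 0 < Fintype.card G := Fintype.card_pos
      positivity
    exact_mod_cast (Real.sqrt_pos.2 this).ne'
  set s := ((Real.sqrt ((D.degree k : ℝ) / (Fintype.card G : ℝ)) : ℝ) : ℂ) with hs_def
  have key : t w = ∑ i, ∑ j, (t (Pi.single i 1) 1 * w j / s) • D.scaledCoeff ⟨k, i, j⟩ := by
    ext x
    have h1 : t w x = t (unitaryRepresentation (D.rep k) x w) 1 := by
      rw [ht, rightRegular_apply, one_mul]
    rw [h1]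
    have h2 : unitaryRepresentation (D.rep k) x w =
        ∑ i, (∑ j, D.coeff k i j x * w j) • Pi.single (M := fun _ => ℂ) i 1 := by
      rw [← pi_eq_sum_univ' (fun i => ∑ j, D.coeff k i j x * w j)]
      rfl
    rw [h2]
    simp only [map_sum, map_smul, WithLp.ofLp_sum, WithLp.ofLp_smul, Finset.sum_apply,
      Pi.smul_apply, smul_eq_mul, scaledCoeff, ← hs_def, Finset.sum_mul]
    refine Finset.sum_congr rfl fun i _ => Finset.sum_congr rfl fun j _ => ?_
    field_simp
  rw [key]
  exact Submodule.sum_mem _ fun i _ => Submodule.sum_mem _ fun j _ =>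
    Submodule.smul_mem _ _ (Submodule.subset_span ⟨_, rfl⟩)

/-- The matrix coefficients of the members of the dual span all functions on `G`. -/
theorem span_scaledCoeff [Fintype G] (D : UnitaryDual G κ) :
    Submodule.span ℂ (Set.range D.scaledCoeff) = ⊤ := by
  classical
  set K := Submodule.span ℂ (Set.range D.scaledCoeff) with hK
  by_contra hne
  have hKinv : ∀ a, ∀ u ∈ K, rightRegular G a u ∈ K := by
    intro a u hu
    have : K ≤ K.comap (rightRegular G a) := by
      rw [hK, Submodule.span_le]
      rintro _ ⟨⟨k, i, j⟩, rfl⟩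
      rw [SetLike.mem_coe, Submodule.mem_comap, rightRegular_scaledCoeff]
      exact Submodule.sum_mem _ fun m _ =>
        Submodule.smul_mem _ _ (Submodule.subset_span ⟨_, rfl⟩)
    exact this hu
  let A : Set (Submodule ℂ (EuclideanSpace ℂ G)) :=
    {W | W ≠ ⊥ ∧ W ≤ Kᗮ ∧ ∀ a, ∀ u ∈ W, rightRegular G a u ∈ W}
  have hA : A.Nonempty := by
    refine ⟨Kᗮ, ?_, le_rfl, ?_⟩
    · intro h
      exact hne ((Submodule.orthogonal_eq_bot_iff).1 h)
    · intro a u hu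
      rw [Submodule.mem_orthogonal] at hu ⊢
      intro v hv
      have := inner_rightRegular a⁻¹ v u
      rw [inv_inv] at this
      rw [← this]
      exact hu _ (hKinv _ _ hv)
  obtain ⟨W, ⟨hW0, hWK, hWinv⟩, hmin⟩ := wellFounded_lt.has_min A hA
  let b := stdOrthonormalBasis ℂ W
  let j : (Fin (Module.finrank ℂ W) → ℂ) →ₗ[ℂ] EuclideanSpace ℂ G :=
    W.subtype ∘ₗ b.toBasis.equivFun.symm.toLinearMap
  have hj : Function.Injective j :=
    W.injective_subtype.comp b.toBasis.equivFun.symm.injective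
  have hjW : ∀ v, j v ∈ W := fun v => (b.toBasis.equivFun.symm v).2
  let r : Representation ℂ G W :=
    { toFun := fun a => (rightRegular G a).restrict (hWinv a)
      map_one' := by ext; simp
      map_mul' := fun a c => by ext; simp }
  have hr : ∀ a u, ((r a u : W) : EuclideanSpace ℂ G) = rightRegular G a u := fun a u => rfl
  let Mx : G →* Matrix (Fin (Module.finrank ℂ W)) (Fin (Module.finrank ℂ W)) ℂ :=
    { toFun := fun a => LinearMap.toMatrix b.toBasis b.toBasis (r a)
      map_one' := by simp
      map_mul' := fun a c => by rw [map_mul, LinearMap.toMatrix_mul] }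
  have hMx : ∀ a p q, Mx a p q = inner ℂ (b p) (r a (b q)) := by
    intro a p q
    change LinearMap.toMatrix b.toBasis b.toBasis (r a) p q = _
    rw [LinearMap.toMatrix_apply]
    simp [OrthonormalBasis.repr_apply_apply]
  have hstar : ∀ a, star (Mx a) = Mx a⁻¹ := by
    intro a
    ext p q
    rw [Matrix.star_apply, hMx, hMx, RCLike.star_def, Submodule.coe_inner, Submodule.coe_inner, hr, hr,
      ← inner_rightRegular]
    exact inner_conj_symm _ _
  let ρ : G →* Matrix.unitaryGroup (Fin (Module.finrank ℂ W)) ℂ :=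
    Mx.codRestrict _ fun a => by
      rw [Matrix.mem_unitaryGroup_iff, hstar, ← map_mul, mul_inv_cancel, map_one]
  have hjρ : ∀ a v, j (unitaryRepresentation ρ a v) = rightRegular G a (j v) := by
    intro a v
    have h1 : b.toBasis.equivFun.symm (unitaryRepresentation ρ a v) =
        r a (b.toBasis.equivFun.symm v) := by
      rw [LinearEquiv.symm_apply_eq]
      have := LinearMap.toMatrix_mulVec_repr b.toBasis b.toBasis (r a)
        (b.toBasis.equivFun.symm v)
      rw [← Module.Basis.equivFun_apply, LinearEquiv.apply_symm_apply] at this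
      rw [Module.Basis.equivFun_apply, ← this]
      rfl
    change ((b.toBasis.equivFun.symm (unitaryRepresentation ρ a v) : W) :
      EuclideanSpace ℂ G) = _
    rw [h1, hr]
    rfl
  have hirr : (unitaryRepresentation ρ).IsIrreducible := by
    have hnt : Nontrivial (Subrepresentation (unitaryRepresentation ρ)) := by
      refine ⟨⊥, ⊤, fun h => hW0 ?_⟩
      have h' : (⊥ : Submodule ℂ (Fin (Module.finrank ℂ W) → ℂ)) = ⊤ :=
        congrArg Subrepresentation.toSubmodule h
      rw [Submodule.eq_bot_iff]
      intro u hu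
      have h3 : b.toBasis.equivFun ⟨u, hu⟩ ∈
          (⊥ : Submodule ℂ (Fin (Module.finrank ℂ W) → ℂ)) := by rw [h']; trivial
      rw [Submodule.mem_bot, LinearEquiv.map_eq_zero_iff] at h3
      exact congrArg Subtype.val h3
    refine { eq_bot_or_eq_top := fun τ => ?_ }
    by_cases hτ : τ = ⊥
    · exact Or.inl hτ
    right
    have hle : τ.toSubmodule.map j ≤ W := by
      rintro _ ⟨v, -, rfl⟩
      exact hjW v
    have hmem : τ.toSubmodule.map j ∈ A := by
      refine ⟨?_, hle.trans hWK, ?_⟩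
      · intro h
        apply hτ
        apply Subrepresentation.toSubmodule_injective
        exact Submodule.map_injective_of_injective hj (h.trans (Submodule.map_bot j).symm)
      · rintro a _ ⟨v, hv, rfl⟩
        exact ⟨_, τ.apply_mem_toSubmodule a hv, hjρ a v⟩
    have heq : τ.toSubmodule.map j = W :=
      hle.eq_or_lt.resolve_right (hmin _ hmem)
    apply Subrepresentation.toSubmodule_injective
    change τ.toSubmodule = ⊤
    rw [Submodule.eq_top_iff']
    intro v
    obtain ⟨v', hv', h⟩ := heq.ge (hjW v)
    rwa [← hj h]
  obtain ⟨k, ⟨e⟩⟩ := D.exists_equiv _ ρ hirr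
  apply hW0
  rw [Submodule.eq_bot_iff]
  intro u hu
  let w := e (b.toBasis.equivFun ⟨u, hu⟩)
  have hmem := D.mem_span_of_intertwines k (j ∘ₗ e.symm.toLinearMap) (fun a w => by
    have h := e.symm.toIntertwiningMap.isIntertwining _ _ a w
    change j (e.symm _) = rightRegular G a (j (e.symm w))
    rw [← hjρ]
    exact congrArg j h) w
  have hw : (j ∘ₗ e.symm.toLinearMap) w = u := by
    change j (e.symm (e _)) = u
    rw [Representation.Equiv.symm_apply_apply]
    change ((b.toBasis.equivFun.symm (b.toBasis.equivFun ⟨u, hu⟩) : W) : EuclideanSpace ℂ G) = u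
    rw [LinearEquiv.symm_apply_apply]
  rw [hw] at hmem
  have := (Submodule.mem_orthogonal K u).1 (hWK hu) u hmem
  exact inner_self_eq_zero.1 this

/-- For a conjugation-invariant `S`, the matrix coefficients are eigenvectors of the adjacency
matrix of `Cay(G; S)`. -/
theorem adjacencyMatrix_mulVec_scaledCoeff [Fintype G] (D : UnitaryDual G κ) (S : Set G)
    (hS : ∀ a, ∀ s ∈ S, a * s * a⁻¹ ∈ S) (p : D.Index) :
    ∃ μ : ℂ, (cayleyGraph S).adjacencyMatrix.mulVec (D.scaledCoeff p).ofLp =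
      μ • (D.scaledCoeff p).ofLp := by
  classical
  obtain ⟨k, i, j⟩ := p
  obtain ⟨c, hc⟩ := D.schur_scalar k (∑ s, if s ∈ S then (D.rep k s).1 else 0) (by
    intro h
    have hS' : ∀ s, h * s * h⁻¹ ∈ S ↔ s ∈ S := fun s =>
      ⟨fun hs => by simpa [mul_assoc] using hS h⁻¹ _ hs, hS h s⟩
    rw [Matrix.sum_mul, Matrix.mul_sum, ← Equiv.sum_comp (MulAut.conj h).toEquiv]
    refine Finset.sum_congr rfl fun s _ => ?_
    have hx : (MulAut.conj h).toEquiv s = h * s * h⁻¹ := rfl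
    rw [hx]
    simp only [hS']
    split_ifs
    · rw [← Submonoid.coe_mul, ← map_mul, inv_mul_cancel_right, map_mul, Submonoid.coe_mul]
    · simp)
  refine ⟨c, ?_⟩
  ext x
  have hx := congrArg (fun Y => ((D.rep k x).1 * Y) i j) hc
  simp only [Matrix.mul_sum, Matrix.sum_apply, Matrix.mul_smul, Matrix.mul_one,
    Matrix.smul_apply, smul_eq_mul] at hx
  simp only [Matrix.mulVec, dotProduct, scaledCoeff, Pi.smul_apply, smul_eq_mul, coeff,
    Digraph.adjacencyMatrix, cayleyGraph, Matrix.of_apply]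
  rw [mul_left_comm, ← hx, Finset.mul_sum, ← Equiv.sum_comp (Equiv.mulLeft x)]
  refine Finset.sum_congr rfl fun s _ => ?_
  simp only [Equiv.coe_mulLeft, inv_mul_cancel_left, map_mul, Submonoid.coe_mul]
  split_ifs <;> simp

/-- The preferred eigenbasis `φ^π_{i,j} = √(d_π / N) π_{i,j}` of the normal Cayley graph
`Cay(G; S)`. -/
noncomputable def cayleyFourierBasis [Fintype G] [Fintype κ] (D : UnitaryDual G κ) (S : Set G)
    (hS : ∀ a, ∀ s ∈ S, a * s * a⁻¹ ∈ S) :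
    GraphFourierBasis (cayleyGraph S).adjacencyMatrix D.Index where
  basis := OrthonormalBasis.mk D.orthonormal_scaledCoeff D.span_scaledCoeff.ge
  eigenvector p := by
    rw [OrthonormalBasis.coe_mk]
    exact D.adjacencyMatrix_mulVec_scaledCoeff S hS p

end UnitaryDual

/-! The transform of `δ_ℓ` at a basis vector `φ` is `conj (φ ℓ)`. If `ĝ` equals `c_π` on the whole
block of `π`, then `c_π` factors out and the block contributes `c_π ∑_{i,j} conj (φ_{i,j}(ℓ))
φ_{i,j}(k)` to `(g * δ_ℓ)(k)`. By unitarity this double sum is `d_π / N` times the trace of `π(ℓ)*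
π(k) = π(ℓ⁻¹ k)`. Hence `(T_ℓ g)(k) = √N ∑_π c_π (d_π / N) χ_π(ℓ⁻¹ k)`, which is
`translate_eq_sum_character`. The translate is thus a class function evaluated at `ℓ⁻¹ k`.
Multiplying `ℓ` and `k` on the left by `m` fixes `ℓ⁻¹ k`; multiplying on the right conjugates it by
`m`, which characters do not see. -/

namespace UnitaryDual

variable {G : Type*} [Group G] {κ : Type*}

/-- The character of the `k`-th member of the dual. -/
noncomputable def character (D : UnitaryDual G κ) (k : κ) (x : G) : ℂ :=
  Matrix.trace (D.rep k x).1

theorem character_mul_comm (D : UnitaryDual G κ) (k : κ) (x y : G) :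
    D.character k (x * y) = D.character k (y * x) := by
  simp only [character, map_mul, Submonoid.coe_mul]
  exact Matrix.trace_mul_comm _ _

/-- Conjugated entries of `π(ℓ)` are the entries of `π(ℓ)* = π(ℓ⁻¹)`, so the sum over both indices
is the trace of a matrix product. A sum over only part of the block would not give a character; this
is where constancy in both `i` and `j` matters. -/
theorem sum_conj_coeff_mul_coeff (D : UnitaryDual G κ) (k : κ) (ℓ x : G) :
    ∑ i, ∑ j, conj (D.coeff k i j ℓ) * D.coeff k i j x = D.character k (ℓ⁻¹ * x) := by
  have hinv : (D.rep k ℓ⁻¹).1 = star (D.rep k ℓ).1 := by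
    rw [map_inv]; rfl
  -- In `π(ℓ)* π(x)` the diagonal position is the column index `j`, and `i` is the summed index of
  -- the product, hence the swap.
  rw [character, map_mul, Submonoid.coe_mul, hinv, Matrix.trace, Finset.sum_comm]
  refine Finset.sum_congr rfl fun j _ => ?_
  rw [Matrix.diag_apply, Matrix.mul_apply]
  rfl

variable [Fintype G] [Fintype κ]

@[simp]
theorem cayleyFourierBasis_basis_apply (D : UnitaryDual G κ) (S : Set G)
    (hS : ∀ a, ∀ s ∈ S, a * s * a⁻¹ ∈ S) (p : D.Index) (x : G) :
    (D.cayleyFourierBasis S hS).basis p x =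
      ((Real.sqrt ((D.degree p.1 : ℝ) / (Fintype.card G : ℝ)) : ℝ) : ℂ) *
        D.coeff p.1 p.2.1 p.2.2 x := by
  simp [cayleyFourierBasis, scaledCoeff]

/-- If the Fourier coefficients of `g` depend only on the representation, then its translates are
combinations of translated characters. -/
theorem translate_eq_sum_character (D : UnitaryDual G κ) (S : Set G)
    (hS : ∀ a, ∀ s ∈ S, a * s * a⁻¹ ∈ S) (g : G → ℂ) (c : κ → ℂ)
    (hg : ∀ (k : κ) (i j : Fin (D.degree k)),
      (D.cayleyFourierBasis S hS).fourier g ⟨k, i, j⟩ = c k) (ℓ x : G) :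
    (D.cayleyFourierBasis S hS).translate ℓ g x =
      ((Real.sqrt (Fintype.card G) : ℝ) : ℂ) *
        ∑ k, c k * ((D.degree k : ℂ) / (Fintype.card G : ℂ)) * D.character k (ℓ⁻¹ * x) := by
  classical
  have hδ : ∀ p : D.Index, (D.cayleyFourierBasis S hS).fourier (Pi.single ℓ 1) p =
      conj ((D.cayleyFourierBasis S hS).basis p ℓ) := fun p => by
    simp [GraphFourierBasis.fourier, Pi.single_apply]
  -- One normalizing root comes from the transform of `δ_ℓ`, the other from Fourier inversion.
  have hs : ∀ k, ((Real.sqrt ((D.degree k : ℝ) / (Fintype.card G : ℝ)) : ℝ) : ℂ) *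
      ((Real.sqrt ((D.degree k : ℝ) / (Fintype.card G : ℝ)) : ℝ) : ℂ) =
      (D.degree k : ℂ) / (Fintype.card G : ℂ) := fun k => by
    rw [← Complex.ofReal_mul, Real.mul_self_sqrt (by positivity)]
    push_cast
    rfl
  rw [GraphFourierBasis.translate, Pi.smul_apply, smul_eq_mul, GraphFourierBasis.conv,
    GraphFourierBasis.fourierInv, Fintype.sum_sigma]
  congr 1
  refine Finset.sum_congr rfl fun k _ => ?_
  -- Expanding the character back into its double sum lets the two sides be compared term by term in
  -- `i` and `j`.
  rw [Fintype.sum_prod_type, ← D.sum_conj_coeff_mul_coeff, Finset.mul_sum]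
  refine Finset.sum_congr rfl fun i _ => ?_
  rw [Finset.mul_sum]
  refine Finset.sum_congr rfl fun j _ => ?_
  rw [Pi.mul_apply, hg, ← hs]
  convert_to c k * conj ((D.cayleyFourierBasis S hS).basis ⟨k, i, j⟩ ℓ) *
    (D.cayleyFourierBasis S hS).basis ⟨k, i, j⟩ x = _
  · rw [← hδ]
  · rw [cayleyFourierBasis_basis_apply, cayleyFourierBasis_basis_apply, map_mul,
      Complex.conj_ofReal]
    ring

end UnitaryDual

theorem mainTheorem12 {G : Type*} [Group G] [Fintype G] {κ : Type*} [Fintype κ]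
    (D : UnitaryDual G κ) (S : Set G) (hS : ∀ a, ∀ s ∈ S, a * s * a⁻¹ ∈ S)
    (g : G → ℂ) (c : κ → ℂ)
    (hg : ∀ (k : κ) (i j : Fin (D.degree k)),
      (D.cayleyFourierBasis S hS).fourier g ⟨k, i, j⟩ = c k) :
    (∀ ℓ k m : G,
      (D.cayleyFourierBasis S hS).translate ℓ g k =
          (D.cayleyFourierBasis S hS).translate (ℓ * m) g (k * m) ∧
        (D.cayleyFourierBasis S hS).translate (ℓ * m) g (k * m) =
          (D.cayleyFourierBasis S hS).translate (m * ℓ) g (m * k)) ∧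
    (∀ ℓ k : G,
      (D.cayleyFourierBasis S hS).translate ℓ g k =
        (D.cayleyFourierBasis S hS).translate 1 g (ℓ⁻¹ * k)) ∧
    (∀ ℓ : G,
      (D.cayleyFourierBasis S hS).translate ℓ g =
        leftRegularOnFunctions G ℓ ((D.cayleyFourierBasis S hS).translate 1 g)) := by
  have h := D.translate_eq_sum_character S hS g c hg
  have h1 : ∀ ℓ k : G, (D.cayleyFourierBasis S hS).translate ℓ g k =
      (D.cayleyFourierBasis S hS).translate 1 g (ℓ⁻¹ * k) := fun ℓ k => by
    rw [h, h, inv_one, one_mul]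
  -- Left invariance needs only `(mℓ)⁻¹(mk) = ℓ⁻¹k`.
  have hl : ∀ ℓ k m : G, (D.cayleyFourierBasis S hS).translate (m * ℓ) g (m * k) =
      (D.cayleyFourierBasis S hS).translate ℓ g k := fun ℓ k m => by
    rw [h1, h1 ℓ k]
    group
  have hr : ∀ ℓ k m : G, (D.cayleyFourierBasis S hS).translate (ℓ * m) g (k * m) =
      (D.cayleyFourierBasis S hS).translate ℓ g k := fun ℓ k m => by
    rw [h, h]
    refine congrArg _ (Finset.sum_congr rfl fun q _ => congrArg _ ?_)
    -- The argument `(ℓm)⁻¹(km)` is `m⁻¹(ℓ⁻¹k)m`; cycling the last factor `m` to the front cancels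
    -- `m⁻¹`. Right invariance is the only place where the class-function property is used.
    rw [← mul_assoc, D.character_mul_comm]
    group
  exact ⟨fun ℓ k m => ⟨(hr ℓ k m).symm, (hr ℓ k m).trans (hl ℓ k m).symm⟩, h1,
    fun ℓ => funext (h1 ℓ)⟩
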